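/- Throughout, a presymplectic space is a finite-dimensional real vector space $V$ with a skew-symmetric, possibly degenerate, bilinear form $\omega$. For a subspace $W\subseteq V$ put $W^\perp=\{v\in V:\omega(v,w)=0\ \forall w\in W\}$, and let $R=V^\perp$ be the radical. An isotropic pair in $V$ is an ordered pair $(A,B)$ of subspaces with $A\subseteq A^\perp$ and $B\subseteq B^\perp$. Isotropic pairs $(A,B)$ in $(V,\omega)$ and $(\hat A,\hat B)$ in $(\hat V,\hat\omega)$ are equivalent if there is a linear isomorphism $\varphi:V\to\hat V$ with $\varphi^*\hat\omega=\omega$, $\varphi(A)=\hat A$ and $\varphi(B)=\hat B$. The pair $(A,B)$ in $V$ is the direct sum of isotropic pairs $(A_j,B_j)$ in subspaces $V_j\subseteq V$ $(1\le j\le m)$, each with the restricted form, if $V=\bigoplus_j V_j$ with the $V_j$ pairwise orthogonal, $A=\bigoplus_j A_j$ and $B=\bigoplus_j B_j$. The pair is indecomposable if $V\neq 0$ and, whenever it is the direct sum of two isotropic pairs in $V_1$ and $V_2$, one has $V_1=0$ or $V_2=0$. **Theorem 4.2.** Consider the following ten isotropic pairs. In $\mathbb R$ with the zero form: (1) $A=0,\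 B=0$; (2) $A=B=\langle e_1\rangle$; (3) $A=\langle e_1\rangle,\ B=0$; (4) $A=0,\ B=\langle e_1\rangle$. In $\mathbb R^3$ with the rank-$2$ form given by $\omega(e_1,e_2)=1$, $e_3\in R$: (5) $A=\langle e_1\rangle,\ B=\langle e_1+e_3\rangle$. In $\mathbb R^2$ with the form given by $\omega(e_1,e_2)=1$: (6) $A=B=\langle e_1\rangle$; (7) $A=\langle e_1\rangle,\ B=0$; (8) $A=0,\ B=\langle e_2\rangle$; (9) $A=\langle e_1\rangle,\ B=\langle e_2\rangle$; (10) $A=0,\ B=0$. Then: (a) Each of these ten pairs is indecomposable, and every indecomposable isotropic pair is equivalent to exactly one of them. (b) Every isotropic pair is a direct sum of finitely many indecomposable isotropic pairs. (c) For $1\le i\le 10$ let $n_i$ be the number of summands equivalent to the $i$-th model in a decomposition of $(A,B)$ into indecomposables. The vector $\mathbf n=(n_1,\dots,n_{10})^T$ depends only on $(A,B)$, not on the decomposition. More precisely, let $\mathbf k=(k_1,\dots,k_{10})^T$ be given by $$k_1=\tfrac12(\dim V-\dim R),\quad k_2=\dim R,\quad k_3=\dim A,\quad k_4=\dim B,\quad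 k_5=\dim (A\cap B),$$ $$k_6=\dim (R\cap A),\quad k_7=\dim (R\cap B),\quad k_8=\dim (R\cap A\cap B),\quad k_9=\dim (R\cap(A+B)),\quad k_{10}=\dim (A^\perp\cap B),$$ and let $$M=\begin{pmatrix} 0&0&0&0&1&1&1&1&1&1\\ 1&1&1&1&1&0&0&0&0&0\\ 0&1&1&0&1&1&1&0&1&0\\ 0&1&0&1&1&1&0&1&1&0\\ 0&1&0&0&0&1&0&0&0&0\\ 0&1&1&0&0&0&0&0&0&0\\ 0&1&0&1&0&0&0&0&0&0\\ 0&1&0&0&0&0&0&0&0&0\\ 0&1&1&1&1&0&0&0&0&0\\ 0&1&0&1&1&1&0&1&0&0 \end{pmatrix}.$$ Then $\det M=1$, so that $M$ is invertible over $\mathbb Z$, and $\mathbf k=M\mathbf n$, $\mathbf n=M^{-1}\mathbf k$. (d) Two isotropic pairs are equivalent if and only if their multiplicities $n_1,\dots,n_{10}$ agree. -/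

import Mathlib

universe u v

/-- A presymplectic structure on a real vector space: a skew-symmetric, possibly degenerate,
bilinear form. -/
structure PresymplecticForm (V : Type u) [AddCommGroup V] [Module ℝ V] where
  /-- the underlying bilinear form -/
  form : LinearMap.BilinForm ℝ V
  skew : ∀ x y, form x y = -form y x

namespace PresymplecticForm

/-- The orthogonal `Wᗮ` of a subspace (by skew-symmetry left and right orthogonals agree). -/
def perp {V : Type u} [AddCommGroup V] [Module ℝ V] (ω : PresymplecticForm V)
    (W : Submodule ℝ V) : Submodule ℝ V :=
  ω.form.orthogonal W

/-- The radical `R = Vᗮ`. -/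
def radical {V : Type u} [AddCommGroup V] [Module ℝ V] (ω : PresymplecticForm V) :
    Submodule ℝ V :=
  ω.perp ⊤

/-- The presymplectic structure induced on a subspace. -/
def restrict {V : Type u} [AddCommGroup V] [Module ℝ V] (ω : PresymplecticForm V)
    (W : Submodule ℝ V) : PresymplecticForm W where
  form := ω.form.restrict W
  skew x y := ω.skew x y

end PresymplecticForm

/-- An isotropic pair `(A, B)` in the presymplectic space `(V, ω)`. -/
structure IsotropicPair {V : Type u} [AddCommGroup V] [Module ℝ V]
    (ω : PresymplecticForm V) where
  /-- the first isotropic subspace -/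
  A : Submodule ℝ V
  /-- the second isotropic subspace -/
  B : Submodule ℝ V
  isotropic_A : A ≤ ω.perp A
  isotropic_B : B ≤ ω.perp B

namespace IsotropicPair

/-- Equivalence (isomorphism) of isotropic pairs: a linear isomorphism of the ambient spaces that
pulls back the second form to the first one and maps `A` onto `A'` and `B` onto `B'`. -/
def Equivalent {V : Type u} [AddCommGroup V] [Module ℝ V] {ω : PresymplecticForm V}
    {V' : Type v} [AddCommGroup V'] [Module ℝ V'] {ω' : PresymplecticForm V'}
    (P : IsotropicPair ω) (P' : IsotropicPair ω') : Prop :=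
  ∃ φ : V ≃ₗ[ℝ] V', (∀ x y, ω'.form (φ x) (φ y) = ω.form x y) ∧
    P.A.map (φ : V →ₗ[ℝ] V') = P'.A ∧ P.B.map (φ : V →ₗ[ℝ] V') = P'.B

/-- `P` is the (internal, orthogonal) direct sum of the isotropic pairs `Q j` in the subspaces
`W j`: the ambient space is the direct sum of the pairwise orthogonal `W j`, and `A`, `B` are the
sums of the first, respectively second, components of the `Q j`. (The latter sums are
automatically direct, since the `j`-th term lies in `W j`.) -/
def IsDirectSum {V : Type u} [AddCommGroup V] [Module ℝ V] {ω : PresymplecticForm V}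
    (P : IsotropicPair ω) {m : ℕ} (W : Fin m → Submodule ℝ V)
    (Q : ∀ j, IsotropicPair (ω.restrict (W j))) : Prop :=
  DirectSum.IsInternal W ∧
  (∀ i j, i ≠ j → ∀ x ∈ W i, ∀ y ∈ W j, ω.form x y = 0) ∧
  P.A = ⨆ j, (Q j).A.map (W j).subtype ∧
  P.B = ⨆ j, (Q j).B.map (W j).subtype

/-- `P` is indecomposable: its ambient space is nonzero, and in every decomposition of `P` as a
direct sum of two isotropic pairs one of the two ambient summands is zero. -/
def IsIndecomposable {V : Type u} [AddCommGroup V] [Module ℝ V] {ω : PresymplecticForm V}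
    (P : IsotropicPair ω) : Prop :=
  Nontrivial V ∧
  ∀ (W : Fin 2 → Submodule ℝ V) (Q : ∀ j, IsotropicPair (ω.restrict (W j))),
    P.IsDirectSum W Q → W 0 = ⊥ ∨ W 1 = ⊥

/-- A decomposition of `P` as a direct sum of indecomposable isotropic pairs. -/
def IsIndecomposableDecomposition {V : Type u} [AddCommGroup V] [Module ℝ V]
    {ω : PresymplecticForm V} (P : IsotropicPair ω) {m : ℕ} (W : Fin m → Submodule ℝ V)
    (Q : ∀ j, IsotropicPair (ω.restrict (W j))) : Prop :=
  P.IsDirectSum W Q ∧ ∀ j, (Q j).IsIndecomposable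

/-- The pair `(⟨a⟩, ⟨b⟩)` of the spans of two vectors. A zero vector gives the zero subspace. -/
def ofVectors {V : Type u} [AddCommGroup V] [Module ℝ V] (ω : PresymplecticForm V) (a b : V) :
    IsotropicPair ω where
  A := Submodule.span ℝ {a}
  B := Submodule.span ℝ {b}
  isotropic_A := by
    have h := ω.skew a a
    have h0 : ω.form a a = 0 := by linarith
    intro x hx y hy
    obtain ⟨s, rfl⟩ := Submodule.mem_span_singleton.1 hx
    obtain ⟨t, rfl⟩ := Submodule.mem_span_singleton.1 hy
    simp [h0]
  isotropic_B := by
    have h := ω.skew b b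
    have h0 : ω.form b b = 0 := by linarith
    intro x hx y hy
    obtain ⟨s, rfl⟩ := Submodule.mem_span_singleton.1 hx
    obtain ⟨t, rfl⟩ := Submodule.mem_span_singleton.1 hy
    simp [h0]

end IsotropicPair

/-- The `n × n` block matrix `[0, I_k, 0; -I_k, 0, 0; 0, 0, 0]` (used with `2 * k ≤ n`). -/
def standardMatrix (n k : ℕ) : Matrix (Fin n) (Fin n) ℝ :=
  Matrix.of fun i j =>
    if (i : ℕ) < k ∧ (j : ℕ) = i + k then 1
    else if (j : ℕ) < k ∧ (i : ℕ) = j + k then -1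
    else 0

theorem standardMatrix_skew (n k : ℕ) (i j : Fin n) :
    standardMatrix n k i j = -standardMatrix n k j i := by
  simp only [standardMatrix, Matrix.of_apply]
  split_ifs <;> first | omega | simp

/-- The standard presymplectic structure of rank `2 * k` on `ℝⁿ`. -/
noncomputable def standardForm (n k : ℕ) : PresymplecticForm (Fin n → ℝ) where
  form := Matrix.toBilin' (standardMatrix n k)
  skew x y := by
    rw [Matrix.toBilin'_apply, Matrix.toBilin'_apply, Finset.sum_comm, ← Finset.sum_neg_distrib]
    refine Finset.sum_congr rfl fun j _ => ?_
    rw [← Finset.sum_neg_distrib]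
    refine Finset.sum_congr rfl fun i _ => ?_
    rw [standardMatrix_skew n k i j]
    ring

/-- Dimensions of the ambient spaces of the ten models (index `i` stands for type `i + 1`). -/
def modelDim : Fin 10 → ℕ := ![1, 1, 1, 1, 3, 2, 2, 2, 2, 2]

/-- Half of the rank of the presymplectic forms of the ten models. -/
def modelHalfRank : Fin 10 → ℕ := ![0, 0, 0, 0, 1, 1, 1, 1, 1, 1]

/-- The ten models (index `i` stands for type `i + 1`), given by a spanning vector of `A` and one
of `B` in `ℝ¹`, `ℝ³` or `ℝ²`. -/
noncomputable def model :
    (i : Fin 10) → IsotropicPair (standardForm (modelDim i) (modelHalfRank i))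
  | 0 => IsotropicPair.ofVectors (standardForm 1 0) ![0] ![0]
  | 1 => IsotropicPair.ofVectors (standardForm 1 0) ![1] ![1]
  | 2 => IsotropicPair.ofVectors (standardForm 1 0) ![1] ![0]
  | 3 => IsotropicPair.ofVectors (standardForm 1 0) ![0] ![1]
  | 4 => IsotropicPair.ofVectors (standardForm 3 1) ![1, 0, 0] ![1, 0, 1]
  | 5 => IsotropicPair.ofVectors (standardForm 2 1) ![1, 0] ![1, 0]
  | 6 => IsotropicPair.ofVectors (standardForm 2 1) ![1, 0] ![0, 0]
  | 7 => IsotropicPair.ofVectors (standardForm 2 1) ![0, 0] ![0, 1]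
  | 8 => IsotropicPair.ofVectors (standardForm 2 1) ![1, 0] ![0, 1]
  | 9 => IsotropicPair.ofVectors (standardForm 2 1) ![0, 0] ![0, 0]

namespace IsotropicPair

/-- The multiplicity of the `i`-th model in a finite family of isotropic pairs: the number of
members of the family that are equivalent to it. -/
noncomputable def multiplicity {V : Type u} [AddCommGroup V] [Module ℝ V]
    {ω : PresymplecticForm V} {m : ℕ} {W : Fin m → Submodule ℝ V}
    (Q : ∀ j, IsotropicPair (ω.restrict (W j))) (i : Fin 10) : ℕ :=
  Nat.card {j : Fin m // (Q j).Equivalent (model i)}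

/-- The vector `k` of the ten dimension invariants of an isotropic pair. -/
noncomputable def invariants {V : Type u} [AddCommGroup V] [Module ℝ V]
    {ω : PresymplecticForm V} (P : IsotropicPair ω) : Fin 10 → ℚ :=
  ![((Module.finrank ℝ V : ℚ) - Module.finrank ℝ ω.radical) / 2,
    Module.finrank ℝ ω.radical,
    Module.finrank ℝ P.A,
    Module.finrank ℝ P.B,
    Module.finrank ℝ (P.A ⊓ P.B : Submodule ℝ V),
    Module.finrank ℝ (ω.radical ⊓ P.A : Submodule ℝ V),
    Module.finrank ℝ (ω.radical ⊓ P.B : Submodule ℝ V),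
    Module.finrank ℝ (ω.radical ⊓ P.A ⊓ P.B : Submodule ℝ V),
    Module.finrank ℝ (ω.radical ⊓ (P.A ⊔ P.B) : Submodule ℝ V),
    Module.finrank ℝ (ω.perp P.A ⊓ P.B : Submodule ℝ V)]

end IsotropicPair

/-- The integer matrix `M` relating the multiplicities to the dimension invariants. -/
def multiplicityMatrix : Matrix (Fin 10) (Fin 10) ℤ :=
  !![0, 0, 0, 0, 1, 1, 1, 1, 1, 1;
     1, 1, 1, 1, 1, 0, 0, 0, 0, 0;
     0, 1, 1, 0, 1, 1, 1, 0, 1, 0;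
     0, 1, 0, 1, 1, 1, 0, 1, 1, 0;
     0, 1, 0, 0, 0, 1, 0, 0, 0, 0;
     0, 1, 1, 0, 0, 0, 0, 0, 0, 0;
     0, 1, 0, 1, 0, 0, 0, 0, 0, 0;
     0, 1, 0, 0, 0, 0, 0, 0, 0, 0;
     0, 1, 1, 1, 1, 0, 0, 0, 0, 0;
     0, 1, 0, 1, 1, 1, 0, 1, 0, 0]

/-! Existence rests on splitting one model off any nonzero pair (`exists_isDirectSum_model`). A
piece splits off once there are a coordinate map `c : V → ℝⁿ` and a section `E` of it such that the
image of `E` is orthogonal to the kernel of `c` and the projection `E ∘ c` preserves `A` and `B`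
(`exists_isDirectSum_of_section`). A nonzero radical vector yields one of types 1 to 5. If the
radical is zero, a hyperbolic plane adapted to `A` and `B` yields one of types 6 to 10. Induction on
the dimension turns every pair into a sum of models.

Uniqueness needs no exchange argument. The ten dimension invariants are additive under orthogonal
sums, and on the `i`-th model they give the `i`-th column of `M`. Hence a sum of models with
multiplicities `n` has invariants `M n`, and since `det M = 1` the invariants determine `n`. The
same count shows that models are indecomposable: if the `i`-th model splits in two, and both parts
are written as sums of models, the multiplicities add up to the `i`-th unit vector, so only one
model occurs in total and the other part is zero. -/

namespace PresymplecticForm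

/-! ### Orthogonal sums of presymplectic spaces -/

variable {V : Type u} [AddCommGroup V] [Module ℝ V] (ω : PresymplecticForm V)

theorem mem_perp {W : Submodule ℝ V} {x : V} : x ∈ ω.perp W ↔ ∀ y ∈ W, ω.form y x = 0 :=
  Iff.rfl

theorem mem_radical {x : V} : x ∈ ω.radical ↔ ∀ y, ω.form y x = 0 := by
  simp [radical, mem_perp]

theorem self_eq_zero (x : V) : ω.form x x = 0 := by
  have h := ω.skew x x
  linarith

/-- The orthogonal direct sum of finitely many presymplectic spaces. -/
def pi {ι : Type} [Fintype ι] {V : ι → Type u} [∀ j, AddCommGroup (V j)] [∀ j, Module ℝ (V j)]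
    (ω : ∀ j, PresymplecticForm (V j)) : PresymplecticForm (∀ j, V j) where
  form := ∑ j, (ω j).form.compl₁₂ (LinearMap.proj j) (LinearMap.proj j)
  skew x y := by
    simp only [LinearMap.sum_apply, LinearMap.compl₁₂_apply, LinearMap.proj_apply]
    rw [← Finset.sum_neg_distrib]
    exact Finset.sum_congr rfl fun j _ => (ω j).skew _ _

theorem pi_form {ι : Type} [Fintype ι] {V : ι → Type u} [∀ j, AddCommGroup (V j)]
    [∀ j, Module ℝ (V j)] (ω : ∀ j, PresymplecticForm (V j)) (x y : ∀ j, V j) :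
    (pi ω).form x y = ∑ j, (ω j).form (x j) (y j) := by
  simp [pi, LinearMap.sum_apply]

theorem perp_pi {ι : Type} [Fintype ι] [DecidableEq ι] {V : ι → Type u}
    [∀ j, AddCommGroup (V j)] [∀ j, Module ℝ (V j)] (ω : ∀ j, PresymplecticForm (V j))
    (S : ∀ j, Submodule ℝ (V j)) :
    (pi ω).perp (Submodule.pi Set.univ S) = Submodule.pi Set.univ fun j => (ω j).perp (S j) := by
  ext x
  simp only [mem_perp, Submodule.mem_pi, Set.mem_univ, true_implies, pi_form]
  refine ⟨fun h j y hy => ?_, fun h y hy => Finset.sum_eq_zero fun j _ => h j _ (hy j)⟩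
  -- Testing against vectors supported in a single factor isolates the `j`-th summand of the form.
  have := h (Pi.single j y) fun i => by
    by_cases hij : i = j
    · subst hij; simpa using hy
    · simp [Pi.single_eq_of_ne hij]
  rw [Finset.sum_eq_single j] at this
  · simpa using this
  · intro i _ hij
    simp [Pi.single_eq_of_ne hij]
  · simp

theorem radical_pi {ι : Type} [Fintype ι] [DecidableEq ι] {V : ι → Type u}
    [∀ j, AddCommGroup (V j)] [∀ j, Module ℝ (V j)] (ω : ∀ j, PresymplecticForm (V j)) :
    (pi ω).radical = Submodule.pi Set.univ fun j => (ω j).radical := by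
  rw [radical, ← Submodule.pi_top (R := ℝ) (φ := V) (s := Set.univ)]
  exact perp_pi ω fun _ => ⊤

end PresymplecticForm

/-! ### Products of subspaces -/

namespace Submodule

/-- A product of submodules is linearly equivalent to the product of the underlying modules. -/
def piUnivEquiv {ι : Type} {V : ι → Type u} [∀ j, AddCommGroup (V j)] [∀ j, Module ℝ (V j)]
    (S : ∀ j, Submodule ℝ (V j)) : Submodule.pi Set.univ S ≃ₗ[ℝ] ∀ j, S j where
  toFun x j := ⟨x.1 j, x.2 j (Set.mem_univ j)⟩
  invFun x := ⟨fun j => x j, fun j _ => (x j).2⟩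
  map_add' _ _ := rfl
  map_smul' _ _ := rfl
  left_inv _ := rfl
  right_inv _ := rfl

theorem finrank_pi_univ {ι : Type} [Fintype ι] {V : ι → Type u} [∀ j, AddCommGroup (V j)]
    [∀ j, Module ℝ (V j)] [∀ j, FiniteDimensional ℝ (V j)] (S : ∀ j, Submodule ℝ (V j)) :
    Module.finrank ℝ (Submodule.pi Set.univ S) = ∑ j, Module.finrank ℝ (S j) := by
  rw [(piUnivEquiv S).finrank_eq, Module.finrank_pi_fintype]

theorem pi_univ_inf {ι : Type} {V : ι → Type u} [∀ j, AddCommGroup (V j)] [∀ j, Module ℝ (V j)]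
    (S T : ∀ j, Submodule ℝ (V j)) :
    Submodule.pi Set.univ S ⊓ Submodule.pi Set.univ T =
      Submodule.pi Set.univ (fun j => S j ⊓ T j) := by
  ext x
  simp [Submodule.mem_pi, forall_and]

theorem pi_univ_sup {ι : Type} {V : ι → Type u} [∀ j, AddCommGroup (V j)] [∀ j, Module ℝ (V j)]
    (S T : ∀ j, Submodule ℝ (V j)) :
    Submodule.pi Set.univ S ⊔ Submodule.pi Set.univ T =
      Submodule.pi Set.univ (fun j => S j ⊔ T j) := by
  ext x
  simp only [Submodule.mem_sup, Submodule.mem_pi, Set.mem_univ, true_implies]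
  constructor
  · rintro ⟨y, hy, z, hz, rfl⟩ j
    exact ⟨y j, hy j, z j, hz j, rfl⟩
  · intro h
    choose y hy z hz hyz using h
    exact ⟨y, hy, z, hz, funext hyz⟩

end Submodule

/-! ### Equivalence of pairs and invariance of the dimensions -/

namespace IsotropicPair

section Equivalence

variable {V : Type u} [AddCommGroup V] [Module ℝ V] {ω : PresymplecticForm V}
  {V' : Type v} [AddCommGroup V'] [Module ℝ V'] {ω' : PresymplecticForm V'}
  {V'' : Type*} [AddCommGroup V''] [Module ℝ V''] {ω'' : PresymplecticForm V''}

/-- Pointwise membership is easier to check than equality of images when the isomorphism is an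
inverse, a composite or a product. -/
theorem equivalent_of_mem_iff {P : IsotropicPair ω} {P' : IsotropicPair ω'} (φ : V ≃ₗ[ℝ] V')
    (hφ : ∀ x y, ω'.form (φ x) (φ y) = ω.form x y) (hA : ∀ x, φ x ∈ P'.A ↔ x ∈ P.A)
    (hB : ∀ x, φ x ∈ P'.B ↔ x ∈ P.B) : P.Equivalent P' := by
  refine ⟨φ, hφ, ?_, ?_⟩
  · ext y
    obtain ⟨x, rfl⟩ := φ.surjective y
    simp [hA]
  · ext y
    obtain ⟨x, rfl⟩ := φ.surjective y
    simp [hB]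

theorem Equivalent.exists_mem_iff {P : IsotropicPair ω} {P' : IsotropicPair ω'}
    (h : P.Equivalent P') : ∃ φ : V ≃ₗ[ℝ] V', (∀ x y, ω'.form (φ x) (φ y) = ω.form x y) ∧
      (∀ x, φ x ∈ P'.A ↔ x ∈ P.A) ∧ ∀ x, φ x ∈ P'.B ↔ x ∈ P.B := by
  obtain ⟨φ, hφ, hA, hB⟩ := h
  refine ⟨φ, hφ, fun x => ?_, fun x => ?_⟩
  · simp [← hA]
  · simp [← hB]

theorem Equivalent.symm {P : IsotropicPair ω} {P' : IsotropicPair ω'} (h : P.Equivalent P') :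
    P'.Equivalent P := by
  obtain ⟨φ, hφ, hA, hB⟩ := h.exists_mem_iff
  refine equivalent_of_mem_iff φ.symm (fun x y => ?_) (fun x => ?_) fun x => ?_
  · simp [← hφ]
  · simp [← hA]
  · simp [← hB]

theorem Equivalent.trans {P : IsotropicPair ω} {P' : IsotropicPair ω'} {P'' : IsotropicPair ω''}
    (h : P.Equivalent P') (h' : P'.Equivalent P'') : P.Equivalent P'' := by
  obtain ⟨φ, hφ, hA, hB⟩ := h.exists_mem_iff
  obtain ⟨ψ, hψ, hA', hB'⟩ := h'.exists_mem_iff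
  refine equivalent_of_mem_iff (φ.trans ψ) (fun x y => ?_) (fun x => ?_) fun x => ?_
  · simp [hψ, hφ]
  · simp [hA', hA]
  · simp [hB', hB]

/-- Transport of an isotropic pair along a linear isometry. -/
def transport (P : IsotropicPair ω) (φ : V ≃ₗ[ℝ] V')
    (hφ : ∀ x y, ω'.form (φ x) (φ y) = ω.form x y) : IsotropicPair ω' where
  A := P.A.map (φ : V →ₗ[ℝ] V')
  B := P.B.map (φ : V →ₗ[ℝ] V')
  isotropic_A := by
    rintro _ ⟨x, hx, rfl⟩ _ ⟨y, hy, rfl⟩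
    exact (hφ y x).trans (P.isotropic_A hx y hy)
  isotropic_B := by
    rintro _ ⟨x, hx, rfl⟩ _ ⟨y, hy, rfl⟩
    exact (hφ y x).trans (P.isotropic_B hx y hy)

theorem equivalent_transport (P : IsotropicPair ω) (φ : V ≃ₗ[ℝ] V')
    (hφ : ∀ x y, ω'.form (φ x) (φ y) = ω.form x y) : P.Equivalent (P.transport φ hφ) :=
  ⟨φ, hφ, rfl, rfl⟩

/-- An isometric isomorphism commutes with orthogonals, intersections and sums, and all ten
invariants are built from these operations and dimensions. -/
theorem Equivalent.invariants_eq {P : IsotropicPair ω} {P' : IsotropicPair ω'}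
    (h : P.Equivalent P') : P.invariants = P'.invariants := by
  obtain ⟨φ, hφ, hA, hB⟩ := h
  have hperp (S : Submodule ℝ V) :
      (ω.perp S).map (φ : V →ₗ[ℝ] V') = ω'.perp (S.map (φ : V →ₗ[ℝ] V')) := by
    ext y
    obtain ⟨x, rfl⟩ := φ.surjective y
    rw [Submodule.mem_map_equiv, LinearEquiv.symm_apply_apply]
    simp only [PresymplecticForm.mem_perp, Submodule.mem_map, forall_exists_index, and_imp,
      forall_apply_eq_imp_iff₂, LinearEquiv.coe_coe, hφ]
  have hR : ω.radical.map (φ : V →ₗ[ℝ] V') = ω'.radical := by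
    rw [PresymplecticForm.radical, hperp, Submodule.map_top, LinearEquiv.range,
      PresymplecticForm.radical]
  have hinf (S T : Submodule ℝ V) : (S ⊓ T).map (φ : V →ₗ[ℝ] V') =
      S.map (φ : V →ₗ[ℝ] V') ⊓ T.map (φ : V →ₗ[ℝ] V') :=
    Submodule.map_inf _ φ.injective
  have hdim (S : Submodule ℝ V) : Module.finrank ℝ S = Module.finrank ℝ (S.map (φ : V →ₗ[ℝ] V')) :=
    (LinearEquiv.finrank_map_eq φ S).symm
  rw [invariants, invariants, φ.finrank_eq, hdim ω.radical, hdim P.A, hdim P.B,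
    hdim (P.A ⊓ P.B), hdim (ω.radical ⊓ P.A), hdim (ω.radical ⊓ P.B),
    hdim (ω.radical ⊓ P.A ⊓ P.B), hdim (ω.radical ⊓ (P.A ⊔ P.B)),
    hdim (ω.perp P.A ⊓ P.B)]
  repeat rw [hinf]
  rw [Submodule.map_sup, hperp, hR, hA, hB]

end Equivalence

/-! ### External direct sums of pairs -/

section Pi

variable {ι : Type} [Fintype ι] {V : ι → Type u} [∀ j, AddCommGroup (V j)]
  [∀ j, Module ℝ (V j)] {ω : ∀ j, PresymplecticForm (V j)}

/-- The external direct sum of finitely many isotropic pairs. -/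
def pi (Q : ∀ j, IsotropicPair (ω j)) : IsotropicPair (PresymplecticForm.pi ω) where
  A := Submodule.pi Set.univ fun j => (Q j).A
  B := Submodule.pi Set.univ fun j => (Q j).B
  isotropic_A := by
    intro x hx y hy
    refine (PresymplecticForm.pi_form ω y x).trans (Finset.sum_eq_zero fun j _ => ?_)
    exact (Q j).isotropic_A (hx j (Set.mem_univ j)) _ (hy j (Set.mem_univ j))
  isotropic_B := by
    intro x hx y hy
    refine (PresymplecticForm.pi_form ω y x).trans (Finset.sum_eq_zero fun j _ => ?_)
    exact (Q j).isotropic_B (hx j (Set.mem_univ j)) _ (hy j (Set.mem_univ j))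

theorem mem_pi_A {Q : ∀ j, IsotropicPair (ω j)} {x : ∀ j, V j} :
    x ∈ (pi Q).A ↔ ∀ j, x j ∈ (Q j).A := by
  simp [pi, Submodule.mem_pi]

theorem mem_pi_B {Q : ∀ j, IsotropicPair (ω j)} {x : ∀ j, V j} :
    x ∈ (pi Q).B ↔ ∀ j, x j ∈ (Q j).B := by
  simp [pi, Submodule.mem_pi]

/-- Radical, orthogonal, intersection and sum of products of subspaces are all formed factor by
factor, so each dimension is a sum over the factors. -/
theorem invariants_pi [∀ j, FiniteDimensional ℝ (V j)] (Q : ∀ j, IsotropicPair (ω j)) :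
    (pi Q).invariants = ∑ j, (Q j).invariants := by
  classical
  have hA : (pi Q).A = Submodule.pi Set.univ fun j => (Q j).A := rfl
  have hB : (pi Q).B = Submodule.pi Set.univ fun j => (Q j).B := rfl
  rw [invariants, hA, hB, PresymplecticForm.radical_pi, PresymplecticForm.perp_pi,
    Submodule.pi_univ_sup, Module.finrank_pi_fintype]
  repeat rw [Submodule.pi_univ_inf]
  repeat rw [Submodule.finrank_pi_univ]
  ext i
  rw [Finset.sum_apply]
  fin_cases i <;> simp [invariants, ← Finset.sum_div]

theorem pi_congr {V' : ι → Type v} [∀ j, AddCommGroup (V' j)] [∀ j, Module ℝ (V' j)]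
    {ω' : ∀ j, PresymplecticForm (V' j)} {Q : ∀ j, IsotropicPair (ω j)}
    {Q' : ∀ j, IsotropicPair (ω' j)} (h : ∀ j, (Q j).Equivalent (Q' j)) :
    (pi Q).Equivalent (pi Q') := by
  choose φ hφ hA hB using fun j => (h j).exists_mem_iff
  refine equivalent_of_mem_iff (LinearEquiv.piCongrRight φ) (fun x y => ?_) (fun x => ?_)
    fun x => ?_
  · simp [PresymplecticForm.pi_form, hφ]
  · simp [mem_pi_A, hA]
  · simp [mem_pi_B, hB]

theorem pi_reindex {κ : Type} [Fintype κ] (σ : κ ≃ ι) (Q : ∀ j, IsotropicPair (ω j)) :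
    (pi Q).Equivalent (pi fun k => Q (σ k)) := by
  refine equivalent_of_mem_iff (LinearEquiv.piCongrLeft ℝ V σ).symm (fun x y => ?_) (fun x => ?_)
    fun x => ?_
  · simp only [PresymplecticForm.pi_form]
    exact σ.sum_comp fun j => (ω j).form (x j) (y j)
  · simp only [mem_pi_A]
    exact σ.forall_congr_right (q := fun j => x j ∈ (Q j).A)
  · simp only [mem_pi_B]
    exact σ.forall_congr_right (q := fun j => x j ∈ (Q j).B)

end Pi

/-- Inductive step for assembling decompositions: a head and an already decomposed tail are merged
into one family. -/
theorem pi_cons {m : ℕ} {V : Fin (m + 1) → Type u} [∀ j, AddCommGroup (V j)]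
    [∀ j, Module ℝ (V j)] {ω : ∀ j, PresymplecticForm (V j)} (Q : ∀ j, IsotropicPair (ω j))
    {W : Fin 2 → Type v} [∀ j, AddCommGroup (W j)] [∀ j, Module ℝ (W j)]
    {ω' : ∀ j, PresymplecticForm (W j)} (Q' : ∀ j, IsotropicPair (ω' j))
    (h0 : (Q' 0).Equivalent (Q 0)) (h1 : (Q' 1).Equivalent (pi fun j => Q (Fin.succ j))) :
    (pi Q').Equivalent (pi Q) := by
  obtain ⟨φ, hφ, hA, hB⟩ := h0.exists_mem_iff
  obtain ⟨ψ, hψ, hA', hB'⟩ := h1.exists_mem_iff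
  refine equivalent_of_mem_iff
    ((LinearEquiv.piFinTwo ℝ W).trans ((φ.prodCongr ψ).trans (Fin.consLinearEquiv ℝ V)))
    (fun x y => ?_) (fun x => ?_) fun x => ?_
  · simp [PresymplecticForm.pi_form, Fin.sum_univ_succ, ← hφ, ← hψ]
  · simp [mem_pi_A, Fin.forall_fin_succ, ← hA, ← hA']
  · simp [mem_pi_B, Fin.forall_fin_succ, ← hB, ← hB']

/-! ### Internal versus external direct sums -/

section Internal

variable {V : Type u} [AddCommGroup V] [Module ℝ V] {ω : PresymplecticForm V}
  {P : IsotropicPair ω} {m : ℕ} {W : Fin m → Submodule ℝ V}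
  {Q : ∀ j, IsotropicPair (ω.restrict (W j))}

/-- The sum map from the product of finitely many subspaces. -/
def sumMap (W : Fin m → Submodule ℝ V) : (∀ j, W j) →ₗ[ℝ] V :=
  ∑ j, (W j).subtype ∘ₗ LinearMap.proj j

theorem sumMap_apply (x : ∀ j, W j) : sumMap W x = ∑ j, (x j : V) := by
  simp [sumMap]

theorem isInternal_iff_bijective_sumMap :
    DirectSum.IsInternal W ↔ Function.Bijective (sumMap W) := by
  have h : DirectSum.coeLinearMap W =
      sumMap W ∘ₗ (DirectSum.linearEquivFunOnFintype ℝ (Fin m) fun j => W j).toLinearMap := by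
    refine DirectSum.linearMap_ext _ fun j => LinearMap.ext fun x => ?_
    simp only [LinearMap.comp_apply, LinearEquiv.coe_coe, DirectSum.coeLinearMap_lof,
      DirectSum.linearEquivFunOnFintype_lof, sumMap_apply]
    rw [Finset.sum_eq_single j]
    · simp
    · intro i _ hij
      simp [Pi.single_eq_of_ne hij]
    · simp
  change Function.Bijective (DirectSum.coeLinearMap W) ↔ _
  rw [h, LinearMap.coe_comp]
  exact Function.Bijective.of_comp_iff _ (LinearEquiv.bijective _)

theorem sumMap_mem_iSup_iff (h : Function.Injective (sumMap W)) (S : ∀ j, Submodule ℝ (W j))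
    (x : ∀ j, W j) : sumMap W x ∈ ⨆ j, (S j).map (W j).subtype ↔ ∀ j, x j ∈ S j := by
  constructor
  · intro hx
    have hle : ⨆ j, (S j).map (W j).subtype ≤ (Submodule.pi Set.univ S).map (sumMap W) := by
      refine iSup_le fun j => ?_
      rintro _ ⟨y, hy, rfl⟩
      refine ⟨Pi.single j y, fun i _ => ?_, ?_⟩
      · by_cases hij : i = j
        · subst hij
          simpa using hy
        · simp [Pi.single_eq_of_ne hij]
      · rw [sumMap_apply, Finset.sum_eq_single j]
        · simp
        · intro i _ hij
          simp [Pi.single_eq_of_ne hij]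
        · simp
    obtain ⟨y, hy, hyx⟩ := hle hx
    rw [← h hyx]
    exact fun j => hy j (Set.mem_univ j)
  · intro hx
    rw [sumMap_apply]
    exact sum_mem fun j _ => Submodule.mem_iSup_of_mem j ⟨x j, hx j, rfl⟩

/-- The sum map is an isometry because orthogonality kills the cross terms, and directness lets
membership in `A` and `B` be read off componentwise. -/
theorem IsDirectSum.pi_equivalent (h : P.IsDirectSum W Q) : (pi Q).Equivalent P := by
  obtain ⟨hW, horth, hA, hB⟩ := h
  have hbij := isInternal_iff_bijective_sumMap.1 hW
  refine equivalent_of_mem_iff (LinearEquiv.ofBijective (sumMap W) hbij) (fun x y => ?_)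
    (fun x => ?_) fun x => ?_
  · simp only [LinearEquiv.ofBijective_apply, sumMap_apply, PresymplecticForm.pi_form, map_sum,
      LinearMap.sum_apply]
    refine Finset.sum_congr rfl fun j _ => ?_
    rw [Finset.sum_eq_single j]
    · rfl
    · intro i _ hij
      exact horth i j hij _ (x i).2 _ (y j).2
    · simp
  · rw [LinearEquiv.ofBijective_apply, hA, sumMap_mem_iSup_iff hbij.1, mem_pi_A]
  · rw [LinearEquiv.ofBijective_apply, hB, sumMap_mem_iSup_iff hbij.1, mem_pi_B]

/-- Converse passage: the images in `V` of the coordinate factors form the internal decomposition.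
-/
theorem exists_isDirectSum_of_equivalent_pi {U : Fin m → Type v} [∀ j, AddCommGroup (U j)]
    [∀ j, Module ℝ (U j)] {ω' : ∀ j, PresymplecticForm (U j)} {Q' : ∀ j, IsotropicPair (ω' j)}
    (h : P.Equivalent (pi Q')) :
    ∃ (W : Fin m → Submodule ℝ V) (Q : ∀ j, IsotropicPair (ω.restrict (W j))),
      P.IsDirectSum W Q ∧ ∀ j, (Q j).Equivalent (Q' j) := by
  obtain ⟨φ, hφ, hA, hB⟩ := h.symm.exists_mem_iff
  let s (j) : U j →ₗ[ℝ] V := φ.toLinearMap ∘ₗ LinearMap.single ℝ U j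
  have hs (j) : Function.Injective (s j) := φ.injective.comp (Pi.single_injective j)
  have hsφ (x : ∀ j, U j) : φ x = ∑ j, s j (x j) := by
    simp only [s, LinearMap.comp_apply, ← map_sum]
    exact congrArg φ (LinearMap.sum_single_apply U x).symm
  have hform (i j) (x : U i) (y : U j) : ω.form (s i x) (s j y) =
      (PresymplecticForm.pi ω').form (Pi.single i x) (Pi.single j y) := hφ _ _
  have hself (i) (x y : U i) : ω.form (s i x) (s i y) = (ω' i).form x y := by
    rw [hform, PresymplecticForm.pi_form, Finset.sum_eq_single i]
    · simp
    · intro k _ hk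
      simp [Pi.single_eq_of_ne hk]
    · simp
  let e (j) : U j ≃ₗ[ℝ] LinearMap.range (s j) := LinearEquiv.ofInjective (s j) (hs j)
  have he (j) (x) : (e j x : V) = s j x := rfl
  have hsup {S : Submodule ℝ V} (T : ∀ j, Submodule ℝ (U j))
      (hST : ∀ x, φ x ∈ S ↔ ∀ j, x j ∈ T j) :
      S = ⨆ j, ((T j).map (e j : U j →ₗ[ℝ] LinearMap.range (s j))).map
        (LinearMap.range (s j)).subtype := by
    refine le_antisymm (fun y hy => ?_) (iSup_le fun j => ?_)
    · obtain ⟨x, rfl⟩ := φ.surjective y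
      rw [hsφ]
      exact sum_mem fun j _ => Submodule.mem_iSup_of_mem j
        ⟨e j (x j), ⟨x j, (hST x).1 hy j, rfl⟩, rfl⟩
    · rintro _ ⟨_, ⟨x, hx, rfl⟩, rfl⟩
      refine (hST (Pi.single j x)).2 fun i => ?_
      by_cases hij : i = j
      · subst hij
        simpa using hx
      · simp [Pi.single_eq_of_ne hij]
  refine ⟨fun j => LinearMap.range (s j), fun j => (Q' j).transport (e j) (hself j),
    ⟨?_, ?_, ?_, ?_⟩, fun j => (equivalent_transport _ _ _).symm⟩
  · rw [isInternal_iff_bijective_sumMap]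
    -- The sum map of the images is `φ` after undoing the identifications `e j` of the factors with
    -- their images.
    convert ((LinearEquiv.piCongrRight e).symm.trans φ).bijective using 1
    ext x
    obtain ⟨y, rfl⟩ := (LinearEquiv.piCongrRight e).surjective x
    simp [hsφ, he, sumMap_apply]
  · rintro i j hij _ ⟨x, rfl⟩ _ ⟨y, rfl⟩
    rw [hform, PresymplecticForm.pi_form]
    refine Finset.sum_eq_zero fun k _ => ?_
    by_cases hk : k = i
    · subst hk
      simp [Pi.single_eq_of_ne hij]
    · simp [Pi.single_eq_of_ne hk]
  · exact hsup (fun j => (Q' j).A) fun x => (hA x).trans mem_pi_A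
  · exact hsup (fun j => (Q' j).B) fun x => (hB x).trans mem_pi_B

end Internal

end IsotropicPair

/-! ### Standard forms and dual vectors -/

namespace PresymplecticForm

theorem standardForm_one_zero (s t : Fin 1 → ℝ) : (standardForm 1 0).form s t = 0 := by
  simp [standardForm, Matrix.toBilin'_apply, standardMatrix]

theorem standardForm_two_one (s t : Fin 2 → ℝ) :
    (standardForm 2 1).form s t = s 0 * t 1 - s 1 * t 0 := by
  simp [standardForm, Matrix.toBilin'_apply, standardMatrix, Fin.sum_univ_succ]
  ring

theorem standardForm_three_one (s t : Fin 3 → ℝ) :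
    (standardForm 3 1).form s t = s 0 * t 1 - s 1 * t 0 := by
  simp [standardForm, Matrix.toBilin'_apply, standardMatrix, Fin.sum_univ_succ]
  ring

variable {V : Type u} [AddCommGroup V] [Module ℝ V] [FiniteDimensional ℝ V]
  (ω : PresymplecticForm V)

/-- A vector outside `S + R` can be paired to one with a vector orthogonal to `S`. -/
theorem exists_mem_perp_form_eq_one {S : Submodule ℝ V} {a : V}
    (ha : ∀ s ∈ S, a - s ∉ ω.radical) : ∃ f ∈ ω.perp S, ω.form a f = 1 := by
  -- If `a` and some `s ∈ S` define the same functional, then `a - s` lies in the radical.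
  have hne : ω.form a ∉ S.map ω.form := by
    rintro ⟨s, hs, hsa⟩
    refine ha s hs (ω.mem_radical.2 fun y => ?_)
    rw [ω.skew, map_sub, hsa, sub_self, LinearMap.zero_apply, neg_zero]
  -- In finite dimension a subspace of the dual is the annihilator of its coannihilator, which is
  -- here the orthogonal of `S`; so some `f` there is not killed by `ω(a, ·)`, and it can be
  -- rescaled.
  rw [← Subspace.dualCoannihilator_dualAnnihilator_eq (W := S.map ω.form),
    Submodule.mem_dualAnnihilator] at hne
  push Not at hne
  obtain ⟨f, hf, hfa⟩ := hne
  refine ⟨(ω.form a f)⁻¹ • f, Submodule.smul_mem _ _ fun s hs => ?_, by simp [hfa]⟩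
  exact (Submodule.mem_dualCoannihilator _).1 hf _ ⟨s, hs, rfl⟩

end PresymplecticForm

/-! ### Splitting off a model -/

namespace IsotropicPair

variable {V : Type u} [AddCommGroup V] [Module ℝ V] {ω : PresymplecticForm V}
  (P : IsotropicPair ω)

/-- The isotropic pair induced on a subspace. -/
def restrict (W : Submodule ℝ V) : IsotropicPair (ω.restrict W) where
  A := P.A.comap W.subtype
  B := P.B.comap W.subtype
  isotropic_A _ hx _ hy := P.isotropic_A hx _ hy
  isotropic_B _ hx _ hy := P.isotropic_B hx _ hy

variable {P}

/-- An isotropic pair splits off a standard piece as soon as the latter is the image of a linear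
section `E` of a linear map `c` to `ℝⁿ` with orthogonal image and kernel, such that the idempotent
`E ∘ c` preserves `A` and `B`. -/
theorem exists_isDirectSum_of_section {n k : ℕ} (c : V →ₗ[ℝ] Fin n → ℝ) (E : (Fin n → ℝ) →ₗ[ℝ] V)
    (hcE : ∀ t, c (E t) = t) (hform : ∀ s t, ω.form (E s) (E t) = (standardForm n k).form s t)
    (horth : ∀ y, c y = 0 → ∀ t, ω.form (E t) y = 0) {a b : Fin n → ℝ}
    (ha : E a ∈ P.A) (hA : ∀ x ∈ P.A, c x ∈ Submodule.span ℝ {a})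
    (hb : E b ∈ P.B) (hB : ∀ x ∈ P.B, c x ∈ Submodule.span ℝ {b}) :
    ∃ (W : Fin 2 → Submodule ℝ V) (Q : ∀ j, IsotropicPair (ω.restrict (W j))),
      P.IsDirectSum W Q ∧ (Q 0).Equivalent (ofVectors (standardForm n k) a b) := by
  have hc (x : V) : c (x - E (c x)) = 0 := by rw [map_sub, hcE, sub_self]
  have hspan {S : Submodule ℝ V} {d : Fin n → ℝ} (hd : E d ∈ S) {t : Fin n → ℝ}
      (ht : t ∈ Submodule.span ℝ {d}) : E t ∈ S := by
    obtain ⟨r, rfl⟩ := Submodule.mem_span_singleton.1 ht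
    rw [map_smul]
    exact S.smul_mem r hd
  -- The splitting is `x = E (c x) + (x - E (c x))`.
  let W : Fin 2 → Submodule ℝ V := ![LinearMap.range E, LinearMap.ker c]
  have hsup {S : Submodule ℝ V} {d : Fin n → ℝ} (hd : E d ∈ S)
      (hS : ∀ x ∈ S, c x ∈ Submodule.span ℝ {d}) :
      S = ⨆ j, (S.comap (W j).subtype).map (W j).subtype := by
    refine le_antisymm (fun x hx => ?_) (iSup_le fun j => Submodule.map_comap_le _ _)
    have hx' : E (c x) ∈ S := hspan hd (hS x hx)
    rw [← add_sub_cancel (E (c x)) x]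
    refine add_mem (Submodule.mem_iSup_of_mem 0 ⟨⟨E (c x), ?_⟩, hx', rfl⟩)
      (Submodule.mem_iSup_of_mem 1 ⟨⟨x - E (c x), ?_⟩, sub_mem hx hx', rfl⟩)
    · exact ⟨c x, rfl⟩
    · exact hc x
  refine ⟨W, fun j => P.restrict (W j), ⟨?_, ?_, hsup ha hA, hsup hb hB⟩, ?_⟩
  · rw [DirectSum.isInternal_submodule_iff_isCompl W (i := 0) (j := 1) (by simp)
      (by ext j; fin_cases j <;> simp)]
    refine ⟨?_, ?_⟩
    · rw [Submodule.disjoint_def]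
      rintro _ ⟨t, rfl⟩ ht
      have : t = 0 := (hcE t).symm.trans ht
      rw [this, map_zero]
    · rw [codisjoint_iff_le_sup]
      intro x _
      exact Submodule.mem_sup.2 ⟨E (c x), ⟨c x, rfl⟩, x - E (c x), hc x, add_sub_cancel _ _⟩
  · intro i j hij x hx y hy
    fin_cases i <;> fin_cases j
    · exact absurd rfl hij
    · obtain ⟨t, rfl⟩ := hx
      exact horth y hy t
    · obtain ⟨t, rfl⟩ := hy
      rw [ω.skew]
      exact neg_eq_zero.2 (horth x hx t)
    · exact absurd rfl hij
  · have hinj : Function.Injective E := Function.LeftInverse.injective hcE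
    refine Equivalent.symm (equivalent_of_mem_iff (LinearEquiv.ofInjective E hinj) hform
      (fun t => ?_) fun t => ?_)
    · refine ⟨fun h => ?_, hspan ha⟩
      rw [← hcE t]
      exact hA _ h
    · refine ⟨fun h => ?_, hspan hb⟩
      rw [← hcE t]
      exact hB _ h

/-- A radical vector is orthogonal to everything, so any hyperplane `ker c` missing it is an
orthogonal complement. In the applications `s` and `t` are `0` or `1`: with `0` the condition says
that `c` kills the subspace, with `1` it is empty. -/
theorem exists_isDirectSum_of_mem_radical {r : V} (hr : r ∈ ω.radical) {c : V →ₗ[ℝ] ℝ}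
    (hcr : c r = 1) {s t : ℝ} (hs : s • r ∈ P.A) (hA : ∀ x ∈ P.A, ∃ z, c x = z * s)
    (ht : t • r ∈ P.B) (hB : ∀ x ∈ P.B, ∃ z, c x = z * t) :
    ∃ (W : Fin 2 → Submodule ℝ V) (Q : ∀ j, IsotropicPair (ω.restrict (W j))),
      P.IsDirectSum W Q ∧ (Q 0).Equivalent (ofVectors (standardForm 1 0) ![s] ![t]) := by
  have hr' (y : V) : ω.form r y = 0 := by rw [ω.skew, ω.mem_radical.1 hr, neg_zero]
  refine exists_isDirectSum_of_section (LinearMap.pi ![c])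
    (Fintype.linearCombination ℝ ![r]) ?_ ?_ ?_ ?_ ?_ ?_ ?_
  · intro t
    ext i
    fin_cases i
    simp [Fintype.linearCombination_apply, hcr]
  · intro s t
    simp [Fintype.linearCombination_apply, hr', PresymplecticForm.standardForm_one_zero]
  · intro y _ t
    simp [Fintype.linearCombination_apply, hr']
  · simpa [Fintype.linearCombination_apply] using hs
  · intro x hx
    obtain ⟨z, hz⟩ := hA x hx
    refine Submodule.mem_span_singleton.2 ⟨z, ?_⟩
    ext i
    fin_cases i
    simp [hz]
  · simpa [Fintype.linearCombination_apply] using ht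
  · intro x hx
    obtain ⟨z, hz⟩ := hB x hx
    refine Submodule.mem_span_singleton.2 ⟨z, ?_⟩
    ext i
    fin_cases i
    simp [hz]

/-- The form is nondegenerate on the plane of `e` and `f`, so its orthogonal is a complement; the
coordinates along `e` and `f` are `ω(x, f)` and `ω(e, x)`. -/
theorem exists_isDirectSum_of_form_eq_one {e f : V} (hef : ω.form e f = 1) {s t : Fin 2 → ℝ}
    (hs : s 0 • e + s 1 • f ∈ P.A)
    (hA : ∀ x ∈ P.A, ∃ z, ω.form x f = z * s 0 ∧ ω.form e x = z * s 1)
    (ht : t 0 • e + t 1 • f ∈ P.B)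
    (hB : ∀ x ∈ P.B, ∃ z, ω.form x f = z * t 0 ∧ ω.form e x = z * t 1) :
    ∃ (W : Fin 2 → Submodule ℝ V) (Q : ∀ j, IsotropicPair (ω.restrict (W j))),
      P.IsDirectSum W Q ∧ (Q 0).Equivalent (ofVectors (standardForm 2 1) s t) := by
  have hfe : ω.form f e = -1 := by rw [ω.skew, hef]
  refine exists_isDirectSum_of_section (LinearMap.pi ![ω.form.flip f, ω.form e])
    (Fintype.linearCombination ℝ ![e, f]) ?_ ?_ ?_ ?_ ?_ ?_ ?_
  · intro t
    ext i
    fin_cases i <;> simp [Fintype.linearCombination_apply, hef, ω.self_eq_zero]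
  · intro s t
    simp [Fintype.linearCombination_apply, PresymplecticForm.standardForm_two_one, hef, hfe,
      ω.self_eq_zero]
    ring
  · intro y hy t
    have h0 : ω.form y f = 0 := congrFun hy 0
    have h1 : ω.form e y = 0 := congrFun hy 1
    simp [Fintype.linearCombination_apply, h1, ω.skew f y, h0]
  · simpa [Fintype.linearCombination_apply] using hs
  · intro x hx
    obtain ⟨z, hz, hz'⟩ := hA x hx
    refine Submodule.mem_span_singleton.2 ⟨z, ?_⟩
    ext i
    fin_cases i <;> simp [hz, hz']
  · simpa [Fintype.linearCombination_apply] using ht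
  · intro x hx
    obtain ⟨z, hz, hz'⟩ := hB x hx
    refine Submodule.mem_span_singleton.2 ⟨z, ?_⟩
    ext i
    fin_cases i <;> simp [hz, hz']

/-- If `A` and `B` meet the radical trivially, but `A + B` does not, the three-dimensional model
splits off. -/
theorem exists_isDirectSum_of_sub_mem_radical [FiniteDimensional ℝ V]
    (hRA : ∀ x ∈ ω.radical, x ∈ P.A → x = 0) (hRB : ∀ x ∈ ω.radical, x ∈ P.B → x = 0)
    {a b : V} (ha : a ∈ P.A) (hb : b ∈ P.B) (hr : b - a ∈ ω.radical) (hne : b - a ≠ 0) :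
    ∃ (W : Fin 2 → Submodule ℝ V) (Q : ∀ j, IsotropicPair (ω.restrict (W j))),
      P.IsDirectSum W Q ∧
        (Q 0).Equivalent (ofVectors (standardForm 3 1) ![1, 0, 0] ![1, 0, 1]) := by
  -- If `a - s` were radical with `s ∈ A ∩ B`, then `a = s` since `R ∩ A = 0`, so `b - a` would lie
  -- in `R ∩ B = 0`.
  obtain ⟨f, hf, haf⟩ := ω.exists_mem_perp_form_eq_one (S := P.A ⊓ P.B) (a := a) (by
    intro s hs has
    have : a = s := sub_eq_zero.1 (hRA _ has (sub_mem ha hs.1))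
    exact hne (hRB _ hr (sub_mem hb (this ▸ hs.2))))
  -- `ω(·, f)` kills `A ∩ B`, whose annihilator is the sum of those of `A` and `B`; `g` is the part
  -- killing `A`. It serves as the coordinate along `r`, and its values on `B` force `B` into the
  -- line of `(1, 0, 1)`.
  obtain ⟨g, hgA, hgB⟩ : ∃ g : V →ₗ[ℝ] ℝ, (∀ x ∈ P.A, g x = 0) ∧
      ∀ x ∈ P.B, g x = ω.form x f := by
    have : ω.form.flip f ∈ (P.A ⊓ P.B).dualAnnihilator :=
      (Submodule.mem_dualAnnihilator _).2 fun x hx => hf x hx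
    rw [Subspace.dualAnnihilator_inf_eq] at this
    obtain ⟨g, hg, h, hh, hgh⟩ := Submodule.mem_sup.1 this
    refine ⟨g, (Submodule.mem_dualAnnihilator _).1 hg, fun x hx => ?_⟩
    have h1 := LinearMap.congr_fun hgh x
    rw [LinearMap.add_apply, (Submodule.mem_dualAnnihilator _).1 hh x hx, add_zero] at h1
    exact h1
  set r := b - a with hrdef
  have hrl (y : V) : ω.form y r = 0 := ω.mem_radical.1 hr y
  have hrr (y : V) : ω.form r y = 0 := by rw [ω.skew, hrl, neg_zero]
  have hba (y : V) : ω.form b y = ω.form a y := by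
    rw [← sub_eq_zero, ← LinearMap.sub_apply, ← map_sub]
    exact hrr y
  have hgr : g r = 1 := by rw [map_sub, hgA a ha, hgB b hb, hba, haf, sub_zero]
  -- Subtracting a radical vector keeps all pairings with `f` and makes the `r`-coordinate of `f'`
  -- vanish.
  set f' := f - g f • r with hf'
  have hff' (x : V) : ω.form x f' = ω.form x f := by simp [hf', hrl]
  have hgf : g f' = 0 := by simp [hf', hgr]
  have haf' : ω.form a f' = 1 := (hff' a).trans haf
  have hfa' : ω.form f' a = -1 := by rw [ω.skew, haf']
  have hga := hgA a ha
  refine exists_isDirectSum_of_section (LinearMap.pi ![ω.form.flip f', ω.form a, g])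
    (Fintype.linearCombination ℝ ![a, f', r]) ?_ ?_ ?_ ?_ ?_ ?_ ?_
  · intro t
    ext i
    fin_cases i <;> simp [Fintype.linearCombination_apply, Fin.sum_univ_succ, haf', ω.self_eq_zero,
      hrr, hrl, hgf, hgr, hga]
  · intro s t
    simp [Fintype.linearCombination_apply, Fin.sum_univ_succ,
      PresymplecticForm.standardForm_three_one, haf', hfa', ω.self_eq_zero, hrr, hrl]
    ring
  · intro y hy t
    have h0 : ω.form y f' = 0 := congrFun hy 0
    have h1 : ω.form a y = 0 := congrFun hy 1
    simp [Fintype.linearCombination_apply, Fin.sum_univ_succ, h1, ω.skew f' y, h0, hrr]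
  · simpa [Fintype.linearCombination_apply, Fin.sum_univ_succ] using ha
  · intro x hx
    have hax : ω.form a x = 0 := P.isotropic_A hx a ha
    refine Submodule.mem_span_singleton.2 ⟨ω.form x f, ?_⟩
    ext i
    fin_cases i <;> simp [hff', hax, hgA x hx]
  · simpa [Fintype.linearCombination_apply, Fin.sum_univ_succ, hrdef] using hb
  · intro x hx
    have hax : ω.form a x = 0 := (hba x).symm.trans (P.isotropic_B hx b hb)
    refine Submodule.mem_span_singleton.2 ⟨ω.form x f, ?_⟩
    ext i
    fin_cases i <;> simp [hff', hax, hgB x hx]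

/-- Every nonzero isotropic pair splits off one of the models. -/
theorem exists_isDirectSum_model [FiniteDimensional ℝ V] [Nontrivial V] (P : IsotropicPair ω) :
    ∃ (W : Fin 2 → Submodule ℝ V) (Q : ∀ j, IsotropicPair (ω.restrict (W j))) (i : Fin 10),
      P.IsDirectSum W Q ∧ (Q 0).Equivalent (model i) := by
  have hmodel (i : Fin 10) (h : ∃ (W : Fin 2 → Submodule ℝ V)
      (Q : ∀ j, IsotropicPair (ω.restrict (W j))),
      P.IsDirectSum W Q ∧ (Q 0).Equivalent (model i)) :
      ∃ (W : Fin 2 → Submodule ℝ V) (Q : ∀ j, IsotropicPair (ω.restrict (W j))) (i : Fin 10),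
        P.IsDirectSum W Q ∧ (Q 0).Equivalent (model i) := by
    obtain ⟨W, Q, h⟩ := h
    exact ⟨W, Q, i, h⟩
  have hfun {S : Submodule ℝ V} {r : V} (hr : r ∉ S) :
      ∃ c : V →ₗ[ℝ] ℝ, c r = 1 ∧ ∀ x ∈ S, c x = 0 := by
    obtain ⟨c, hc, hS⟩ := Submodule.exists_le_ker_of_notMem hr
    refine ⟨(c r)⁻¹ • c, by simp [hc], fun x hx => ?_⟩
    simp [LinearMap.mem_ker.1 (hS hx)]
  -- With nonzero radical the cases are: `R` meets `A`, `R` meets `B`, `R` contains a nonzero vector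
  -- of `A + B`, or the chosen `r` avoids `A + B`. In each, `c` is chosen to kill whatever subspace
  -- must not see `r`.
  by_cases hR : ∃ r ∈ ω.radical, r ≠ 0
  · obtain ⟨r, hr, hr0⟩ := hR
    by_cases hRA : ∃ r ∈ ω.radical, r ∈ P.A ∧ r ≠ 0
    · obtain ⟨r, hr, hrA, hr0⟩ := hRA
      by_cases hrB : r ∈ P.B
      · obtain ⟨c, hc, -⟩ := hfun (S := ⊥) hr0
        exact hmodel 1 (exists_isDirectSum_of_mem_radical hr hc (by simpa using hrA)
          (fun x _ => ⟨c x, (mul_one _).symm⟩) (by simpa using hrB)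
          fun x _ => ⟨c x, (mul_one _).symm⟩)
      · obtain ⟨c, hc, hcB⟩ := hfun hrB
        exact hmodel 2 (exists_isDirectSum_of_mem_radical hr hc (by simpa using hrA)
          (fun x _ => ⟨c x, (mul_one _).symm⟩) (by simp) fun x hx => ⟨0, by simp [hcB x hx]⟩)
    push Not at hRA
    by_cases hRB : ∃ r ∈ ω.radical, r ∈ P.B ∧ r ≠ 0
    · obtain ⟨r, hr, hrB, hr0⟩ := hRB
      obtain ⟨c, hc, hcA⟩ := hfun fun h => hr0 (hRA r hr h)
      exact hmodel 3 (exists_isDirectSum_of_mem_radical hr hc (by simp)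
        (fun x hx => ⟨0, by simp [hcA x hx]⟩) (by simpa using hrB)
        fun x _ => ⟨c x, (mul_one _).symm⟩)
    push Not at hRB
    by_cases hrAB : r ∈ P.A ⊔ P.B
    · obtain ⟨a, ha, b, hb, rfl⟩ := Submodule.mem_sup.1 hrAB
      rw [show a + b = b - -a by abel] at hr hr0
      exact hmodel 4 (exists_isDirectSum_of_sub_mem_radical hRA hRB (neg_mem ha) hb hr hr0)
    · obtain ⟨c, hc, hcAB⟩ := hfun hrAB
      exact hmodel 0 (exists_isDirectSum_of_mem_radical hr hc (s := 0) (t := 0) (by simp)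
        (fun x hx => ⟨0, by simp [hcAB x (Submodule.mem_sup_left hx)]⟩) (by simp)
        fun x hx => ⟨0, by simp [hcAB x (Submodule.mem_sup_right hx)]⟩)
  push Not at hR
  -- The form is now nondegenerate. A common vector of `A` and `B` needs any partner; next, a
  -- nonzero pairing between `A` and `B` gives type 9; after that `A` and `B` are mutually
  -- orthogonal.
  by_cases hAB : ∃ e ∈ P.A ⊓ P.B, e ≠ 0
  · obtain ⟨e, ⟨heA, heB⟩, he0⟩ := hAB
    obtain ⟨f, -, hef⟩ := ω.exists_mem_perp_form_eq_one (S := ⊥) (a := e) (by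
      rintro s rfl h
      exact he0 (by simpa using hR _ h))
    exact hmodel 5 (exists_isDirectSum_of_form_eq_one hef (by simpa using heA)
      (fun x hx => ⟨ω.form x f, by simpa using P.isotropic_A hx e heA⟩) (by simpa using heB)
      fun x hx => ⟨ω.form x f, by simpa using P.isotropic_B hx e heB⟩)
  push Not at hAB
  by_cases hω : ∃ a ∈ P.A, ∃ b ∈ P.B, ω.form a b ≠ 0
  · obtain ⟨a, ha, b, hb, hab⟩ := hω
    have hb' : (ω.form a b)⁻¹ • b ∈ P.B := P.B.smul_mem _ hb
    exact hmodel 8 (exists_isDirectSum_of_form_eq_one (e := a) (f := (ω.form a b)⁻¹ • b)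
      (by simp [hab]) (by simpa using ha)
      (fun x hx => ⟨_, (mul_one _).symm, by simpa using P.isotropic_A hx a ha⟩)
      (by simpa using hb')
      fun x hx => ⟨_, by simpa using P.isotropic_B hb' x hx, (mul_one _).symm⟩)
  push Not at hω
  by_cases hA : ∃ a ∈ P.A, a ≠ 0
  · obtain ⟨a, ha, ha0⟩ := hA
    -- `A ∩ B = 0` puts `a` outside `B`, so the partner can be taken orthogonal to `B`; then `B`
    -- lies in the complement.
    obtain ⟨f, hf, haf⟩ := ω.exists_mem_perp_form_eq_one (S := P.B) (a := a) (by
      intro s hs h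
      exact ha0 (hAB a ⟨ha, sub_eq_zero.1 (hR _ h) ▸ hs⟩))
    exact hmodel 6 (exists_isDirectSum_of_form_eq_one haf (by simpa using ha)
      (fun x hx => ⟨_, (mul_one _).symm, by simpa using P.isotropic_A hx a ha⟩) (by simp)
      fun x hx => ⟨0, by simpa using hf x hx, by simpa using hω a ha x hx⟩)
  push Not at hA
  by_cases hB : ∃ b ∈ P.B, b ≠ 0
  · obtain ⟨b, hb, hb0⟩ := hB
    obtain ⟨e, -, hbe⟩ := ω.exists_mem_perp_form_eq_one (S := ⊥) (a := b) (by
      rintro s rfl h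
      exact hb0 (by simpa using hR _ h))
    -- In type 8 the vector of `B` is the second basis vector, so the partner comes first and
    -- changes sign.
    have heb : ω.form (-e) b = 1 := by rw [ω.skew, map_neg, neg_neg, hbe]
    exact hmodel 7 (exists_isDirectSum_of_form_eq_one heb (by simp)
      (fun x hx => ⟨0, by simp [hA x hx]⟩) (by simpa using hb)
      fun x hx => ⟨_, by simpa using P.isotropic_B hb x hx, (mul_one _).symm⟩)
  push Not at hB
  obtain ⟨e, he0⟩ := exists_ne (0 : V)
  obtain ⟨f, -, hef⟩ := ω.exists_mem_perp_form_eq_one (S := ⊥) (a := e) (by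
    rintro s rfl h
    exact he0 (by simpa using hR _ h))
  exact hmodel 9 (exists_isDirectSum_of_form_eq_one hef (by simp)
    (fun x hx => ⟨0, by simp [hA x hx]⟩) (by simp) fun x hx => ⟨0, by simp [hB x hx]⟩)

end IsotropicPair

/-! ### The matrix of the model invariants -/

/-- After an even permutation of the rows, `M` is the product of a lower and an upper triangular
integer matrix with unit diagonals. -/
theorem multiplicityMatrix_det : multiplicityMatrix.det = 1 := by
  let L : Fin 10 → Fin 10 → ℤ :=
    ![![1, 0, 0, 0, 0, 0, 0, 0, 0, 0],
      ![0, 1, 0, 0, 0, 0, 0, 0, 0, 0],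
      ![0, 1, 1, 0, 0, 0, 0, 0, 0, 0],
      ![0, 1, 0, 1, 0, 0, 0, 0, 0, 0],
      ![0, 1, 1, 1, 1, 0, 0, 0, 0, 0],
      ![0, 1, 0, 0, 0, 1, 0, 0, 0, 0],
      ![0, 1, 1, 0, 1, 1, 1, 0, 0, 0],
      ![0, 1, 0, 1, 1, 1, 0, 1, 0, 0],
      ![0, 1, 0, 1, 1, 1, 0, 1, 1, 0],
      ![0, 0, 0, 0, 1, 1, 1, 1, 0, 1]]
  let U : Fin 10 → Fin 10 → ℤ :=
    ![![1, 1, 1, 1, 1, 0, 0, 0, 0, 0],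
      ![0, 1, 0, 0, 0, 0, 0, 0, 0, 0],
      ![0, 0, 1, 0, 0, 0, 0, 0, 0, 0],
      ![0, 0, 0, 1, 0, 0, 0, 0, 0, 0],
      ![0, 0, 0, 0, 1, 0, 0, 0, 0, 0],
      ![0, 0, 0, 0, 0, 1, 0, 0, 0, 0],
      ![0, 0, 0, 0, 0, 0, 1, 0, 1, 0],
      ![0, 0, 0, 0, 0, 0, 0, 1, 0, 0],
      ![0, 0, 0, 0, 0, 0, 0, 0, 1, 0],
      ![0, 0, 0, 0, 0, 0, 0, 0, 0, 1]]
  let σ : Equiv.Perm (Fin 10) :=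
    ⟨![1, 7, 5, 6, 8, 4, 2, 9, 3, 0], ![9, 0, 6, 8, 5, 2, 3, 1, 4, 7], by decide, by decide⟩
  have hLU : multiplicityMatrix.submatrix σ id = Matrix.of L * Matrix.of U := by decide
  have hL : (Matrix.of L).det = 1 := by
    rw [Matrix.det_of_isLowerTriangular (Matrix.of L) fun i j h =>
      (by decide : ∀ i j : Fin 10, i < j → L i j = 0) i j h]
    decide
  have hU : (Matrix.of U).det = 1 := by
    rw [Matrix.det_of_isUpperTriangular (M := Matrix.of U) fun i j h =>
      (by decide : ∀ i j : Fin 10, j < i → U i j = 0) i j h]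
    decide
  have hσ : Equiv.Perm.sign σ = 1 := by decide
  have h := Matrix.det_permute σ multiplicityMatrix
  rw [hLU, Matrix.det_mul, hL, hU, hσ] at h
  simpa using h.symm

theorem multiplicityMatrix_inv_mulVec (n : Fin 10 → ℚ) :
    (multiplicityMatrix⁻¹.map (Int.cast : ℤ → ℚ)).mulVec
      ((multiplicityMatrix.map (Int.cast : ℤ → ℚ)).mulVec n) = n := by
  have h : multiplicityMatrix⁻¹ * multiplicityMatrix = 1 :=
    Matrix.nonsing_inv_mul _ (by rw [multiplicityMatrix_det]; exact isUnit_one)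
  have h' := congrArg (fun A : Matrix (Fin 10) (Fin 10) ℤ => A.map (Int.castRingHom ℚ)) h
  rw [Matrix.map_mul, Matrix.map_one _ (map_zero _) (map_one _)] at h'
  rw [Matrix.mulVec_mulVec]
  exact (congrArg (fun A => A.mulVec n) h').trans (Matrix.one_mulVec n)

theorem multiplicityMatrix_mulVec_injective :
    Function.Injective (multiplicityMatrix.map (Int.cast : ℤ → ℚ)).mulVec :=
  Function.LeftInverse.injective multiplicityMatrix_inv_mulVec

/-! ### The invariants of the models -/

namespace IsotropicPair

section Invariants

variable {V : Type u} [AddCommGroup V] [Module ℝ V] {ω : PresymplecticForm V}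
  (P : IsotropicPair ω)

theorem invariants_of_form_eq_zero (h : ∀ x y, ω.form x y = 0) :
    P.invariants = ![0, (Module.finrank ℝ V : ℚ), Module.finrank ℝ P.A, Module.finrank ℝ P.B,
      Module.finrank ℝ (P.A ⊓ P.B : Submodule ℝ V), Module.finrank ℝ P.A, Module.finrank ℝ P.B,
      Module.finrank ℝ (P.A ⊓ P.B : Submodule ℝ V), Module.finrank ℝ (P.A ⊔ P.B : Submodule ℝ V),
      Module.finrank ℝ P.B] := by
  have hp (S : Submodule ℝ V) : ω.perp S = ⊤ := eq_top_iff.2 fun x _ y _ => h y x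
  rw [invariants, PresymplecticForm.radical, hp, hp]
  repeat rw [top_inf_eq]
  simp

theorem invariants_of_radical_eq_bot (h : ω.radical = ⊥) :
    P.invariants = ![(Module.finrank ℝ V : ℚ) / 2, 0, Module.finrank ℝ P.A, Module.finrank ℝ P.B,
      Module.finrank ℝ (P.A ⊓ P.B : Submodule ℝ V), 0, 0, 0, 0,
      Module.finrank ℝ (ω.perp P.A ⊓ P.B : Submodule ℝ V)] := by
  rw [invariants, h]
  repeat rw [bot_inf_eq]
  simp

end Invariants

end IsotropicPair

theorem standardForm_two_one_radical : (standardForm 2 1).radical = ⊥ := by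
  refine (Submodule.eq_bot_iff _).2 fun x hx => ?_
  rw [PresymplecticForm.mem_radical] at hx
  have h0 := hx ![0, 1]
  have h1 := hx ![1, 0]
  simp only [PresymplecticForm.standardForm_two_one, Matrix.cons_val_zero, Matrix.cons_val_one,
    zero_mul, one_mul, zero_sub, neg_eq_zero, sub_zero] at h0 h1
  ext i
  fin_cases i <;> simp [h0, h1]

theorem standardForm_three_one_radical :
    (standardForm 3 1).radical = Submodule.span ℝ {![0, 0, 1]} := by
  ext x
  rw [PresymplecticForm.mem_radical, Submodule.mem_span_singleton]
  constructor
  · intro hx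
    have h0 := hx ![0, 1, 0]
    have h1 := hx ![1, 0, 0]
    simp only [PresymplecticForm.standardForm_three_one, Matrix.cons_val_zero, Matrix.cons_val_one,
      zero_mul, one_mul, zero_sub, neg_eq_zero, sub_zero] at h0 h1
    refine ⟨x 2, ?_⟩
    ext i
    fin_cases i <;> simp [h0, h1]
  · rintro ⟨t, rfl⟩ y
    simp [PresymplecticForm.standardForm_three_one]

theorem span_vec_one : Submodule.span ℝ {(![1] : Fin 1 → ℝ)} = ⊤ := by
  refine eq_top_iff.2 fun x _ => Submodule.mem_span_singleton.2 ⟨x 0, ?_⟩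
  ext i
  fin_cases i
  simp

theorem span_vec_zero_one : Submodule.span ℝ {(![0] : Fin 1 → ℝ)} = ⊥ := by
  rw [Submodule.span_singleton_eq_bot]
  simp

theorem span_vec_zero_two : Submodule.span ℝ {(![0, 0] : Fin 2 → ℝ)} = ⊥ := by
  rw [Submodule.span_singleton_eq_bot]
  simp

theorem span_inf_span_eq_bot {n : ℕ} {a b : Fin n → ℝ} (i : Fin n) (ha : a i = 0) (hb : b i ≠ 0) :
    Submodule.span ℝ {a} ⊓ Submodule.span ℝ {b} = ⊥ := by
  refine (Submodule.eq_bot_iff _).2 fun x ⟨hx, hx'⟩ => ?_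
  obtain ⟨s, rfl⟩ := Submodule.mem_span_singleton.1 hx
  obtain ⟨t, ht⟩ := Submodule.mem_span_singleton.1 hx'
  have := congrFun ht i
  simp only [Pi.smul_apply, smul_eq_mul, ha, mul_zero, mul_eq_zero, hb, or_false] at this
  rw [← ht, this, zero_smul]

namespace IsotropicPair

theorem ofVectors_A {V : Type u} [AddCommGroup V] [Module ℝ V] (ω : PresymplecticForm V)
    (a b : V) : (ofVectors ω a b).A = Submodule.span ℝ {a} :=
  rfl

theorem ofVectors_B {V : Type u} [AddCommGroup V] [Module ℝ V] (ω : PresymplecticForm V)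
    (a b : V) : (ofVectors ω a b).B = Submodule.span ℝ {b} :=
  rfl

/-- The form vanishes for types 1 to 4 and is nondegenerate for types 6 to 10, which settles most
entries; only type 5 needs its radical, the line of the third basis vector. -/
theorem model_invariants (i : Fin 10) :
    (model i).invariants = fun k => (multiplicityMatrix k i : ℚ) := by
  have h1 (P : IsotropicPair (standardForm 1 0)) :=
    P.invariants_of_form_eq_zero PresymplecticForm.standardForm_one_zero
  have h2 (P : IsotropicPair (standardForm 2 1)) :=
    P.invariants_of_radical_eq_bot standardForm_two_one_radical
  have hpbot {V : Type} [AddCommGroup V] [Module ℝ V] (ω : PresymplecticForm V) :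
      ω.perp ⊥ = ⊤ := eq_top_iff.2 fun x _ y hy => by
    rw [(Submodule.mem_bot ℝ).1 hy]
    simp
  have hf2 {a : Fin 2 → ℝ} (ha : a ≠ 0) : Module.finrank ℝ (Submodule.span ℝ {a}) = 1 :=
    finrank_span_singleton ha
  have hf3 {a : Fin 3 → ℝ} (ha : a ≠ 0) : Module.finrank ℝ (Submodule.span ℝ {a}) = 1 :=
    finrank_span_singleton ha
  have e1 : (![1, 0] : Fin 2 → ℝ) ≠ 0 := fun h => by simpa using congrFun h 0
  have e2 : (![0, 1] : Fin 2 → ℝ) ≠ 0 := fun h => by simpa using congrFun h 1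
  fin_cases i
  · refine (h1 (ofVectors _ ![0] ![0])).trans ?_
    rw [ofVectors_A, ofVectors_B]
    rw [span_vec_zero_one, bot_inf_eq, bot_sup_eq]
    ext k
    fin_cases k <;> simp [multiplicityMatrix]
  · refine (h1 (ofVectors _ ![1] ![1])).trans ?_
    rw [ofVectors_A, ofVectors_B]
    rw [span_vec_one, top_inf_eq, top_sup_eq]
    ext k
    fin_cases k <;> simp [multiplicityMatrix]
  · refine (h1 (ofVectors _ ![1] ![0])).trans ?_
    rw [ofVectors_A, ofVectors_B]
    rw [span_vec_one, span_vec_zero_one, inf_bot_eq, top_sup_eq]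
    ext k
    fin_cases k <;> simp [multiplicityMatrix]
  · refine (h1 (ofVectors _ ![0] ![1])).trans ?_
    rw [ofVectors_A, ofVectors_B]
    rw [span_vec_one, span_vec_zero_one, bot_inf_eq, bot_sup_eq]
    ext k
    fin_cases k <;> simp [multiplicityMatrix]
  · change (ofVectors (standardForm 3 1) ![1, 0, 0] ![1, 0, 1]).invariants = _
    have e1 : (![1, 0, 0] : Fin 3 → ℝ) ≠ 0 := fun h => by simpa using congrFun h 0
    have e3 : (![0, 0, 1] : Fin 3 → ℝ) ≠ 0 := fun h => by simpa using congrFun h 2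
    have e13 : (![1, 0, 1] : Fin 3 → ℝ) ≠ 0 := fun h => by simpa using congrFun h 0
    have hperp : Submodule.span ℝ {![1, 0, 1]} ≤
        (standardForm 3 1).perp (Submodule.span ℝ {![1, 0, 0]}) := by
      intro x hx y hy
      obtain ⟨s, rfl⟩ := Submodule.mem_span_singleton.1 hx
      obtain ⟨t, rfl⟩ := Submodule.mem_span_singleton.1 hy
      simp [PresymplecticForm.standardForm_three_one]
    have hsup : Submodule.span ℝ {(![0, 0, 1] : Fin 3 → ℝ)} ≤
        Submodule.span ℝ {![1, 0, 0]} ⊔ Submodule.span ℝ {![1, 0, 1]} := by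
      rw [Submodule.span_singleton_le_iff_mem]
      rw [show (![0, 0, 1] : Fin 3 → ℝ) = -![1, 0, 0] + ![1, 0, 1] by ext i; fin_cases i <;> simp]
      exact Submodule.add_mem_sup (neg_mem (Submodule.mem_span_singleton_self _))
        (Submodule.mem_span_singleton_self _)
    rw [invariants, standardForm_three_one_radical]
    rw [ofVectors_A, ofVectors_B]
    rw [inf_eq_left.2 hsup, inf_eq_right.2 hperp,
      span_inf_span_eq_bot (a := ![1, 0, 0]) (b := ![1, 0, 1]) 2 (by simp) (by simp),
      span_inf_span_eq_bot (a := ![0, 0, 1]) (b := ![1, 0, 0]) 0 (by simp) (by simp),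
      span_inf_span_eq_bot (a := ![0, 0, 1]) (b := ![1, 0, 1]) 0 (by simp) (by simp), bot_inf_eq,
      hf3 e1, hf3 e3, hf3 e13]
    ext k
    fin_cases k <;> norm_num [multiplicityMatrix]
  · refine (h2 (ofVectors _ ![1, 0] ![1, 0])).trans ?_
    have hp := (ofVectors (standardForm 2 1) ![1, 0] ![1, 0]).isotropic_A
    rw [ofVectors_A] at hp
    rw [ofVectors_A, ofVectors_B]
    rw [inf_eq_right.2 hp, inf_idem, hf2 e1]
    ext k
    fin_cases k <;> simp [multiplicityMatrix]
  · refine (h2 (ofVectors _ ![1, 0] ![0, 0])).trans ?_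
    rw [ofVectors_A, ofVectors_B]
    rw [span_vec_zero_two, inf_bot_eq, inf_bot_eq, hf2 e1]
    ext k
    fin_cases k <;> simp [multiplicityMatrix]
  · refine (h2 (ofVectors _ ![0, 0] ![0, 1])).trans ?_
    rw [ofVectors_A, ofVectors_B]
    rw [span_vec_zero_two, bot_inf_eq, hpbot, top_inf_eq, hf2 e2]
    ext k
    fin_cases k <;> simp [multiplicityMatrix]
  · refine (h2 (ofVectors _ ![1, 0] ![0, 1])).trans ?_
    have hp : (standardForm 2 1).perp (Submodule.span ℝ {![1, 0]}) ⊓ Submodule.span ℝ {![0, 1]} =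
        ⊥ := by
      refine (Submodule.eq_bot_iff _).2 fun x ⟨hx, hx'⟩ => ?_
      obtain ⟨s, rfl⟩ := Submodule.mem_span_singleton.1 hx'
      have := hx _ (Submodule.mem_span_singleton_self _)
      simp only [PresymplecticForm.standardForm_two_one] at this
      rw [show s = 0 by simpa using this, zero_smul]
    rw [ofVectors_A, ofVectors_B]
    rw [hp, span_inf_span_eq_bot (a := ![1, 0]) (b := ![0, 1]) 1 (by simp) (by simp), hf2 e1,
      hf2 e2]
    ext k
    fin_cases k <;> simp [multiplicityMatrix]
  · refine (h2 (ofVectors _ ![0, 0] ![0, 0])).trans ?_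
    rw [ofVectors_A, ofVectors_B]
    rw [span_vec_zero_two, bot_inf_eq, inf_bot_eq]
    ext k
    fin_cases k <;> simp [multiplicityMatrix]

end IsotropicPair

/-! ### Classification and multiplicities -/

namespace IsotropicPair

variable {V : Type u} [AddCommGroup V] [Module ℝ V] {ω : PresymplecticForm V}

theorem model_injective {i j : Fin 10} (h : (model i).invariants = (model j).invariants) :
    i = j := by
  have hinj : ∀ i j : Fin 10, (∀ k, multiplicityMatrix k i = multiplicityMatrix k j) → i = j := by
    decide
  rw [model_invariants, model_invariants] at h
  exact hinj i j fun k => by exact_mod_cast congrFun h k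

theorem invariants_pi_model {m : ℕ} (t : Fin m → Fin 10) :
    (pi fun j => model (t j)).invariants = (multiplicityMatrix.map (Int.cast : ℤ → ℚ)).mulVec
      (∑ j, Pi.single (t j) 1) := by
  rw [invariants_pi, Matrix.mulVec_sum]
  refine Finset.sum_congr rfl fun j _ => ?_
  rw [model_invariants, Matrix.mulVec_single_one]
  rfl

theorem pi_equivalent_of_subsingleton {W : Fin 2 → Type v} [∀ j, AddCommGroup (W j)]
    [∀ j, Module ℝ (W j)] {ω : ∀ j, PresymplecticForm (W j)} (Q : ∀ j, IsotropicPair (ω j))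
    [Subsingleton (W 1)] : (pi Q).Equivalent (Q 0) := by
  have h1 (x : W 1) : x = 0 := Subsingleton.elim _ _
  let _ : Unique (W 1) := uniqueOfSubsingleton 0
  refine equivalent_of_mem_iff ((LinearEquiv.piFinTwo ℝ W).trans LinearEquiv.prodUnique)
    (fun x y => ?_) (fun x => ?_) fun x => ?_
  · simp [PresymplecticForm.pi_form, h1 (x 1)]
  · simp [mem_pi_A, h1 (x 1)]
  · simp [mem_pi_B, h1 (x 1)]

theorem Equivalent.finrank_pos {P : IsotropicPair ω} {i : Fin 10} (h : P.Equivalent (model i)) :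
    0 < Module.finrank ℝ V := by
  obtain ⟨φ, -⟩ := h
  rw [φ.finrank_eq, Module.finrank_fin_fun]
  exact (by decide : ∀ i, 0 < modelDim i) i

/-- Every isotropic pair is equivalent to an external direct sum of models. -/
theorem exists_equivalent_pi_model [FiniteDimensional ℝ V] (P : IsotropicPair ω) :
    ∃ (m : ℕ) (t : Fin m → Fin 10), P.Equivalent (pi fun j => model (t j)) := by
  induction h : Module.finrank ℝ V using Nat.strong_induction_on generalizing V with
  | _ n ih =>
    rcases subsingleton_or_nontrivial V with hV | hV
    · refine ⟨0, Fin.elim0, equivalent_of_mem_iff 0 (fun x y => ?_) (fun x => ?_) fun x => ?_⟩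
      · simp [Subsingleton.elim x 0]
      · simp [Subsingleton.elim x 0]
      · simp [Subsingleton.elim x 0]
    · obtain ⟨W, Q, i, hQ, hi⟩ := P.exists_isDirectSum_model
      -- The split-off model has positive dimension, so the complement `W 1` falls under the
      -- induction hypothesis.
      have hdim : Module.finrank ℝ (W 0) + Module.finrank ℝ (W 1) = n := by
        obtain ⟨φ, -⟩ := hQ.pi_equivalent
        rw [← h, ← φ.finrank_eq, Module.finrank_pi_fintype, Fin.sum_univ_two]
      have hpos := hi.finrank_pos
      obtain ⟨m, t, ht⟩ := ih (Module.finrank ℝ (W 1)) (by omega) (Q 1) rfl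
      let t' : Fin (m + 1) → Fin 10 := Fin.cons i t
      exact ⟨m + 1, t', hQ.pi_equivalent.symm.trans (pi_cons (fun j => model (t' j)) Q hi ht)⟩

/-- A decomposition into two parts, each expanded into models, has the invariants of one model;
injectivity of `M` then bounds the number of models by one. -/
theorem Equivalent.isIndecomposable {P : IsotropicPair ω} {i : Fin 10}
    (h : P.Equivalent (model i)) : P.IsIndecomposable := by
  have hpos := h.finrank_pos
  have : FiniteDimensional ℝ V := FiniteDimensional.of_finrank_pos hpos
  refine ⟨Module.finrank_pos_iff.1 hpos, fun W Q hQ => ?_⟩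
  obtain ⟨m₀, t₀, h₀⟩ := (Q 0).exists_equivalent_pi_model
  obtain ⟨m₁, t₁, h₁⟩ := (Q 1).exists_equivalent_pi_model
  have hinv := hQ.pi_equivalent.invariants_eq
  have hmodel : (model i).invariants = (multiplicityMatrix.map (Int.cast : ℤ → ℚ)).mulVec
      (Pi.single i 1) := by
    rw [model_invariants, Matrix.mulVec_single_one]
    rfl
  rw [h.invariants_eq, invariants_pi, Fin.sum_univ_two, h₀.invariants_eq, h₁.invariants_eq,
    invariants_pi_model, invariants_pi_model, hmodel, ← Matrix.mulVec_add] at hinv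
  -- The sum of the multiplicities is the number of summands, so this equation reads `m₀ + m₁ = 1`.
  have hcount := congrArg (fun n : Fin 10 → ℚ => ∑ k, n k)
    (multiplicityMatrix_mulVec_injective hinv)
  have hsum {m : ℕ} (t : Fin m → Fin 10) :
      ∑ k, (∑ j, Pi.single (t j) (1 : ℚ) : Fin 10 → ℚ) k = m := by
    simp_rw [Finset.sum_apply]
    rw [Finset.sum_comm]
    simp
  simp only [Pi.add_apply, Finset.sum_add_distrib, hsum, Finset.sum_pi_single', Finset.mem_univ,
    if_true] at hcount
  have hcount' : m₀ + m₁ = 1 := by exact_mod_cast hcount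
  have hbot {j : Fin 2} {t : Fin 0 → Fin 10} (hj : (Q j).Equivalent (pi fun j => model (t j))) :
      W j = ⊥ := by
    obtain ⟨φ, -⟩ := hj
    have := φ.toEquiv.subsingleton
    exact Submodule.eq_bot_of_subsingleton
  rcases Nat.eq_zero_or_pos m₀ with rfl | hm
  · exact Or.inl (hbot h₀)
  · obtain rfl : m₁ = 0 := by omega
    exact Or.inr (hbot h₁)

theorem model_isIndecomposable (i : Fin 10) : (model i).IsIndecomposable :=
  Equivalent.isIndecomposable
    (equivalent_of_mem_iff (LinearEquiv.refl ℝ _) (fun _ _ => rfl) (fun _ => Iff.rfl)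
      fun _ => Iff.rfl)

theorem IsIndecomposable.existsUnique_equivalent_model [FiniteDimensional ℝ V]
    {P : IsotropicPair ω} (h : P.IsIndecomposable) : ∃! i : Fin 10, P.Equivalent (model i) := by
  -- Indecomposability forces the complement of the split-off model to vanish, so the pair is that
  -- model.
  have := h.1
  obtain ⟨W, Q, i, hQ, hi⟩ := P.exists_isDirectSum_model
  have h1 : W 1 = ⊥ := (h.2 W Q hQ).resolve_left fun h0 => by
    have := hi.finrank_pos
    rw [h0, finrank_bot] at this
    exact lt_irrefl _ this
  have : Subsingleton (W 1) := by
    rw [h1]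
    infer_instance
  have hP := (hQ.pi_equivalent.symm.trans (pi_equivalent_of_subsingleton Q)).trans hi
  exact ⟨i, hP, fun j hj => model_injective (hj.symm.trans hP).invariants_eq⟩

theorem exists_isIndecomposableDecomposition [FiniteDimensional ℝ V] (P : IsotropicPair ω) :
    ∃ (m : ℕ) (W : Fin m → Submodule ℝ V) (Q : ∀ j, IsotropicPair (ω.restrict (W j))),
      P.IsIndecomposableDecomposition W Q := by
  obtain ⟨m, t, ht⟩ := P.exists_equivalent_pi_model
  obtain ⟨W, Q, hQ, hQt⟩ := exists_isDirectSum_of_equivalent_pi ht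
  exact ⟨m, W, Q, hQ, fun j => (hQt j).isIndecomposable⟩

section Decomposition

variable [FiniteDimensional ℝ V] {P : IsotropicPair ω} {m : ℕ} {W : Fin m → Submodule ℝ V}
  {Q : ∀ j, IsotropicPair (ω.restrict (W j))}

/-- The types of the summands of a decomposition into indecomposables. -/
theorem IsIndecomposableDecomposition.exists_types (h : P.IsIndecomposableDecomposition W Q) :
    ∃ t : Fin m → Fin 10, P.Equivalent (pi fun j => model (t j)) ∧
      ∀ i, multiplicity Q i = Nat.card {j // t j = i} := by
  choose t ht htu using fun j => (h.2 j).existsUnique_equivalent_model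
  refine ⟨t, h.1.pi_equivalent.symm.trans (pi_congr ht), fun i => Nat.card_congr ?_⟩
  refine Equiv.subtypeEquivRight fun j => ⟨fun hj => (htu j i hj).symm, ?_⟩
  rintro rfl
  exact ht j

theorem IsIndecomposableDecomposition.invariants_eq (h : P.IsIndecomposableDecomposition W Q) :
    P.invariants = (multiplicityMatrix.map (Int.cast : ℤ → ℚ)).mulVec
      (fun i => (multiplicity Q i : ℚ)) := by
  obtain ⟨t, ht, hmult⟩ := h.exists_types
  rw [ht.invariants_eq, invariants_pi_model]
  congr 1
  ext i
  rw [hmult, Nat.card_eq_fintype_card, Fintype.card_subtype, Finset.sum_apply]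
  simp [Pi.single_apply, eq_comm]

theorem multiplicity_eq_of_invariants_eq {V' : Type v} [AddCommGroup V'] [Module ℝ V']
    [FiniteDimensional ℝ V'] {ω' : PresymplecticForm V'} {P' : IsotropicPair ω'} {m' : ℕ}
    {W' : Fin m' → Submodule ℝ V'} {Q' : ∀ j, IsotropicPair (ω'.restrict (W' j))}
    (h : P.IsIndecomposableDecomposition W Q) (h' : P'.IsIndecomposableDecomposition W' Q')
    (hinv : P.invariants = P'.invariants) : multiplicity Q = multiplicity Q' := by
  rw [h.invariants_eq, h'.invariants_eq] at hinv
  ext i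
  exact_mod_cast congrFun (multiplicityMatrix_mulVec_injective hinv) i

theorem equivalent_of_multiplicity_eq {V' : Type v} [AddCommGroup V'] [Module ℝ V']
    [FiniteDimensional ℝ V'] {ω' : PresymplecticForm V'} {P' : IsotropicPair ω'} {m' : ℕ}
    {W' : Fin m' → Submodule ℝ V'} {Q' : ∀ j, IsotropicPair (ω'.restrict (W' j))}
    (h : P.IsIndecomposableDecomposition W Q) (h' : P'.IsIndecomposableDecomposition W' Q')
    (hmult : ∀ i, multiplicity Q i = multiplicity Q' i) : P.Equivalent P' := by
  obtain ⟨t, ht, hm⟩ := h.exists_types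
  obtain ⟨t', ht', hm'⟩ := h'.exists_types
  have hcard (i : Fin 10) : Nonempty ({j // t j = i} ≃ {j // t' j = i}) :=
    Finite.card_eq.1 (by rw [← hm, ← hm', hmult])
  -- Equal multiplicities mean equinumerous fibres of `t` and `t'`; gluing the fibrewise bijections
  -- matches the summands type by type.
  let σ : Fin m ≃ Fin m' := (Equiv.sigmaFiberEquiv t).symm.trans
    ((Equiv.sigmaCongrRight fun i => (hcard i).some).trans (Equiv.sigmaFiberEquiv t'))
  -- Forgetting how `σ` was built from `t` allows `t` to be substituted.
  obtain ⟨τ, hτ⟩ : ∃ τ : Fin m ≃ Fin m', t = fun j => t' (τ j) :=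
    ⟨σ, funext fun j => ((hcard (t j)).some ⟨j, rfl⟩).2.symm⟩
  subst hτ
  exact ht.trans ((pi_reindex τ fun j => model (t' j)).symm.trans ht'.symm)

end Decomposition

end IsotropicPair

theorem theorem4p2 :
    -- the ten models are indecomposable
    (∀ i : Fin 10, (model i).IsIndecomposable) ∧
    -- every indecomposable isotropic pair is equivalent to exactly one of them
    (∀ (V : Type u) [AddCommGroup V] [Module ℝ V] [FiniteDimensional ℝ V]
      (ω : PresymplecticForm V) (P : IsotropicPair ω),
      P.IsIndecomposable → ∃! i : Fin 10, P.Equivalent (model i)) ∧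
    -- every isotropic pair is a direct sum of indecomposable ones
    (∀ (V : Type u) [AddCommGroup V] [Module ℝ V] [FiniteDimensional ℝ V]
      (ω : PresymplecticForm V) (P : IsotropicPair ω),
      ∃ (m : ℕ) (W : Fin m → Submodule ℝ V) (Q : ∀ j, IsotropicPair (ω.restrict (W j))),
        P.IsIndecomposableDecomposition W Q) ∧
    -- the multiplicities do not depend on the decomposition
    (∀ (V : Type u) [AddCommGroup V] [Module ℝ V] [FiniteDimensional ℝ V]
      (ω : PresymplecticForm V) (P : IsotropicPair ω)
      (m : ℕ) (W : Fin m → Submodule ℝ V) (Q : ∀ j, IsotropicPair (ω.restrict (W j)))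
      (m' : ℕ) (W' : Fin m' → Submodule ℝ V) (Q' : ∀ j, IsotropicPair (ω.restrict (W' j))),
      P.IsIndecomposableDecomposition W Q → P.IsIndecomposableDecomposition W' Q' →
      IsotropicPair.multiplicity Q = IsotropicPair.multiplicity Q') ∧
    -- `M` has determinant `1`, `k = M n` and `n = M⁻¹ k`
    multiplicityMatrix.det = 1 ∧
    (∀ (V : Type u) [AddCommGroup V] [Module ℝ V] [FiniteDimensional ℝ V]
      (ω : PresymplecticForm V) (P : IsotropicPair ω)
      (m : ℕ) (W : Fin m → Submodule ℝ V) (Q : ∀ j, IsotropicPair (ω.restrict (W j))),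
      P.IsIndecomposableDecomposition W Q →
      P.invariants = (multiplicityMatrix.map (Int.cast : ℤ → ℚ)).mulVec
          (fun i => (IsotropicPair.multiplicity Q i : ℚ)) ∧
      (fun i => (IsotropicPair.multiplicity Q i : ℚ)) =
        (multiplicityMatrix⁻¹.map (Int.cast : ℤ → ℚ)).mulVec P.invariants) ∧
    -- two isotropic pairs are equivalent iff their multiplicities agree
    (∀ (V : Type u) [AddCommGroup V] [Module ℝ V] [FiniteDimensional ℝ V]
      (ω : PresymplecticForm V) (P : IsotropicPair ω)
      (V' : Type v) [AddCommGroup V'] [Module ℝ V'] [FiniteDimensional ℝ V']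
      (ω' : PresymplecticForm V') (P' : IsotropicPair ω')
      (m : ℕ) (W : Fin m → Submodule ℝ V) (Q : ∀ j, IsotropicPair (ω.restrict (W j)))
      (m' : ℕ) (W' : Fin m' → Submodule ℝ V') (Q' : ∀ j, IsotropicPair (ω'.restrict (W' j))),
      P.IsIndecomposableDecomposition W Q → P'.IsIndecomposableDecomposition W' Q' →
      (P.Equivalent P' ↔
        ∀ i : Fin 10, IsotropicPair.multiplicity Q i = IsotropicPair.multiplicity Q' i)) := by
  refine ⟨IsotropicPair.model_isIndecomposable,
    fun V _ _ _ ω P h => h.existsUnique_equivalent_model,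
    fun V _ _ _ ω P => P.exists_isIndecomposableDecomposition,
    fun V _ _ _ ω P m W Q m' W' Q' h h' =>
      IsotropicPair.multiplicity_eq_of_invariants_eq h h' rfl,
    multiplicityMatrix_det,
    fun V _ _ _ ω P m W Q h => ⟨h.invariants_eq, ?_⟩,
    fun V _ _ _ ω P V' _ _ _ ω' P' m W Q m' W' Q' h h' =>
      ⟨fun hP => congrFun (IsotropicPair.multiplicity_eq_of_invariants_eq h h' hP.invariants_eq),
        IsotropicPair.equivalent_of_multiplicity_eq h h'⟩⟩
  rw [h.invariants_eq, multiplicityMatrix_inv_mulVec]
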